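/- Let $n \ge 1$ be an integer and let $\epsilon < 1$ be a real number. Let $X_1, Z_1, \ldots, X_n, Z_n$ be Hermitian matrices acting on the same finite-dimensional complex Hilbert space $\mathcal{H}$, each having all its eigenvalues in $[-1, -1+\epsilon] \cup [1-\epsilon, 1]$, such that $\|\{X_j, Z_j\}\| \le \epsilon$ for all $j$, and $\|[S_i, T_j]\| \le \epsilon$ for all $i \ne j$ and all $S, T \in \{X, Z\}$. Here $[A,B] = AB - BA$, $\{A,B\} = AB + BA$, and $\|\cdot\|$ is the operator norm. Assume $\frac{\epsilon}{(1-\epsilon)^2} \le \frac{1}{64 n}$. Then there exist reflections (Hermitian matrices squaring to the identity) $X_1', Z_1', \ldots, X_n', Z_n'$ on $\mathcal{H}$ such that $\{X_j', Z_j'\} = 0$ for all $j$, $[S_i', T_j'] = 0$ for all $i \ne j$ and all $S, T \in \{X, Z\}$, and \[ \|S_j' - S_j\| \le \frac{4 n \epsilon}{(1-\epsilon)^2} + \epsilon \qquad \text{for all } j \text{ and } S \in \{X, Z\}. \] -/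

import Mathlib

open scoped Matrix.Norms.L2Operator

/-- A reflection: a Hermitian matrix that squares to the identity
(all of its eigenvalues are `1` or `-1`). -/
def IsReflectionMatrix {ι : Type*} [Fintype ι] [DecidableEq ι] (R : Matrix ι ι ℂ) : Prop :=
  R.IsHermitian ∧ R * R = 1

/-- The set `[-1, -1 + ε] ∪ [1 - ε, 1]` of real numbers in which the eigenvalues lie. -/
def nearSignSet (ε : ℝ) : Set ℝ :=
  Set.Icc (-1) (-1 + ε) ∪ Set.Icc (1 - ε) 1

/-- A Hermitian matrix all of whose (real) eigenvalues lie in `[-1, -1 + ε] ∪ [1 - ε, 1]`.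
`spectrum ℝ A` is the set of real `t` for which `t • 1 - A` is not invertible. -/
def IsNearReflectionMatrix {ι : Type*} [Fintype ι] [DecidableEq ι] (ε : ℝ)
    (A : Matrix ι ι ℂ) : Prop :=
  A.IsHermitian ∧ spectrum ℝ A ⊆ nearSignSet ε

/-- The commutator `[A, B]`. -/
def matComm {ι : Type*} [Fintype ι] (A B : Matrix ι ι ℂ) : Matrix ι ι ℂ :=
  A * B - B * A

/-- The anticommutator `{A, B}`. -/
def matAnticomm {ι : Type*} [Fintype ι] (A B : Matrix ι ι ℂ) : Matrix ι ι ℂ :=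
  A * B + B * A

/-!
Replace every operator by its sign; this multiplies twisted commutators by at most `(1 - ε)⁻²`, to
`δ = ε / (1 - ε)²`, and it remains to treat reflections that satisfy their sign relations
`S T = ± T S` up to `δ`. Given one of them, `R`, replace every other one, `S`, by the sign of
`P = (S ± R S R) / 2`, which satisfies its relation with `R` exactly. Since `S` and `± R S R` are
both reflections, `1 - P²` is of second order, so `P` is almost a reflection; and conjugation by
`R` preserves the relations, so the parts `P` satisfy each other's relations up to the old error
plus a second order term. One step thus turns an error `d` into at most `d / (1 - d)`, that is, the
inverse of the error drops by one, and exact relations stay exact. Doing this for all `2n`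
reflections keeps the error below `2 δ` as long as `2 n δ ≤ 1 / 2`, and moves each reflection by at
most `2 δ` in each step.
-/

/-- A reflection of a star ring: a self-adjoint square root of `1`. -/
def IsStarReflection {A : Type*} [Mul A] [One A] [Star A] (R : A) : Prop :=
  IsSelfAdjoint R ∧ R * R = 1

/-- A self-adjoint element whose spectrum lies within `ε` of `{-1, 1}`, inside `[-1, 1]`. -/
def IsNearStarReflection {A : Type*} [Ring A] [Algebra ℝ A] [Star A] (ε : ℝ) (B : A) : Prop :=
  IsSelfAdjoint B ∧ spectrum ℝ B ⊆ nearSignSet ε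

/-- The twisted commutator `S T - c T S`, which treats commutators (`c = 1`) and anticommutators
(`c = -1`) uniformly. -/
def twistedComm {A : Type*} [Ring A] (c : ℤˣ) (S T : A) : A :=
  S * T - c • (T * S)

/-- The involution `S ↦ a R S R` attached to a reflection `R`; its fixed points are the `S` with
`R S = a S R`. -/
def twistedConj {A : Type*} [Ring A] (a : ℤˣ) (R S : A) : A :=
  a • (R * S * R)

/-- The component `(S + a R S R) / 2` of `S` that satisfies `R S = a S R`, for a reflection `R`. -/
noncomputable def twistedPart {A : Type*} [Ring A] [Module ℝ A] (a : ℤˣ) (R S : A) : A :=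
  midpoint ℝ S (twistedConj a R S)

/-- `U` is a reflection that commutes with `B` and is within `t` of it. For `t < 1` and `B`
self-adjoint this makes `U` the sign of `B`. -/
structure IsRounding {A : Type*} [NormedRing A] [Star A] (t : ℝ) (U B : A) : Prop where
  isStarReflection : IsStarReflection U
  commute : Commute U B
  near : ‖U - B‖ ≤ t

theorem IsStarReflection.mem_unitary {A : Type*} [Monoid A] [StarMul A] {R : A}
    (hR : IsStarReflection R) : R ∈ unitary A := by
  rw [Unitary.mem_iff, hR.1.star_eq]
  exact ⟨hR.2, hR.2⟩

section Ring

variable {A : Type*} [Ring A] {R S T : A}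

theorem twistedComm_one (S T : A) : twistedComm 1 S T = S * T - T * S := by
  simp only [twistedComm, one_smul]

theorem twistedComm_neg_one (S T : A) : twistedComm (-1) S T = S * T + T * S := by
  simp only [twistedComm, Units.neg_smul, one_smul, sub_neg_eq_add]

theorem twistedComm_one_self (S : A) : twistedComm 1 S S = 0 := by
  rw [twistedComm_one, sub_self]

theorem twistedComm_swap (c : ℤˣ) (S T : A) :
    twistedComm c T S = -(c • twistedComm c S T) := by
  rw [twistedComm, twistedComm, smul_sub, smul_smul, Int.units_mul_self, one_smul, neg_sub]

theorem twistedConj_one_self (hR : R * R = 1) : twistedConj 1 R R = R := by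
  rw [twistedConj, one_smul, hR, one_mul]

theorem twistedConj_mul_twistedConj (hR : R * R = 1) (a b : ℤˣ) (S T : A) :
    twistedConj a R S * twistedConj b R T = (a * b) • (R * (S * T) * R) := by
  have hRR : R * S * R * (R * T * R) = R * (S * T) * R := by
    calc R * S * R * (R * T * R) = R * S * (R * R) * T * R := by noncomm_ring
      _ = R * (S * T) * R := by rw [hR]; noncomm_ring
  rw [twistedConj, twistedConj, smul_mul_smul_comm, hRR]

theorem twistedConj_mul_self (hR : R * R = 1) (hS : S * S = 1) (a : ℤˣ) :
    twistedConj a R S * twistedConj a R S = 1 := by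
  rw [twistedConj_mul_twistedConj hR, hS, Int.units_mul_self, one_smul, mul_one, hR]

theorem twistedComm_twistedConj (hR : R * R = 1) (a b c : ℤˣ) (S T : A) :
    twistedComm c (twistedConj a R S) (twistedConj b R T) =
      (a * b) • (R * twistedComm c S T * R) := by
  rw [twistedComm, twistedConj_mul_twistedConj hR, twistedConj_mul_twistedConj hR, twistedComm,
    mul_sub, sub_mul, smul_sub, mul_smul_comm, smul_mul_assoc, smul_comm c, mul_comm b a]

theorem sub_twistedConj (hR : R * R = 1) (a : ℤˣ) (S : A) :
    S - twistedConj a R S = -(a • (twistedComm a R S * R)) := by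
  rw [twistedComm, twistedConj, sub_mul, smul_mul_assoc, mul_assoc S, hR, mul_one, smul_sub,
    smul_smul, Int.units_mul_self, one_smul, neg_sub]

theorem twistedComm_twistedConj_right (hR : R * R = 1) (a : ℤˣ) (S : A) :
    twistedComm a R (twistedConj a R S) = -twistedComm a R S := by
  have hleft : R * (R * S * R) = S * R := by rw [mul_assoc R, ← mul_assoc R R, hR, one_mul]
  have hright : R * S * R * R = R * S := by rw [mul_assoc, hR, mul_one]
  rw [twistedComm, twistedConj, mul_smul_comm, smul_mul_assoc, hleft, hright, smul_smul,
    Int.units_mul_self, one_smul, twistedComm, neg_sub]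

end Ring

section Midpoint

variable {A : Type*} [Ring A] [Algebra ℝ A] {R S S' T T' : A}

theorem twistedComm_midpoint_midpoint (c : ℤˣ) (S S' T T' : A) :
    twistedComm c (midpoint ℝ S S') (midpoint ℝ T T') =
      (1 / 2 : ℝ) • (twistedComm c S T + twistedComm c S' T') -
        (1 / 4 : ℝ) • twistedComm c (S - S') (T - T') := by
  simp only [midpoint_eq_smul_add, invOf_eq_inv]
  rcases Int.units_eq_one_or c with rfl | rfl <;>
    simp only [twistedComm_one, twistedComm_neg_one, smul_mul_smul_comm, mul_add, add_mul, mul_sub,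
      sub_mul] <;>
    module

theorem one_sub_midpoint_mul_self (hS : S * S = 1) (hS' : S' * S' = 1) :
    1 - midpoint ℝ S S' * midpoint ℝ S S' = (1 / 4 : ℝ) • ((S - S') * (S - S')) := by
  simp only [midpoint_eq_smul_add, invOf_eq_inv, smul_mul_smul_comm, mul_add, add_mul, mul_sub,
    sub_mul, hS, hS']
  module

theorem twistedPart_one_self (hR : R * R = 1) : twistedPart 1 R R = R := by
  rw [twistedPart, twistedConj_one_self hR, midpoint_self]

theorem twistedComm_twistedPart_eq_zero (hR : R * R = 1) (a : ℤˣ) (S : A) :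
    twistedComm a R (twistedPart a R S) = 0 := by
  have h := twistedComm_midpoint_midpoint a R R S (twistedConj a R S)
  rw [midpoint_self, twistedComm_twistedConj_right hR, add_neg_cancel, smul_zero, sub_self] at h
  rw [twistedPart, h]
  simp only [twistedComm, zero_mul, mul_zero, smul_zero, sub_zero]

theorem isSelfAdjoint_twistedPart [StarRing A] [StarModule ℝ A] (hR : IsSelfAdjoint R)
    (hS : IsSelfAdjoint S) (a : ℤˣ) : IsSelfAdjoint (twistedPart a R S) := by
  have hRSR : IsSelfAdjoint (R * S * R) := by simpa only [hR.star_eq] using hS.conjugate R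
  have hconj : IsSelfAdjoint (twistedConj a R S) := by
    rcases Int.units_eq_one_or a with rfl | rfl
    · simpa only [twistedConj, one_smul] using hRSR
    · simpa only [twistedConj, Units.neg_smul, one_smul] using hRSR.neg
  rw [twistedPart, midpoint_eq_smul_add]
  exact (IsSelfAdjoint.all _).smul (hS.add hconj)

end Midpoint

section NormedRing

variable {A : Type*} [NormedRing A]

theorem norm_twistedComm_swap (c : ℤˣ) (S T : A) :
    ‖twistedComm c T S‖ = ‖twistedComm c S T‖ := by
  rw [twistedComm_swap, norm_neg, norm_units_zsmul]

theorem norm_twistedComm_le (c : ℤˣ) (S T : A) : ‖twistedComm c S T‖ ≤ 2 * (‖S‖ * ‖T‖) :=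
  calc ‖twistedComm c S T‖ ≤ ‖S * T‖ + ‖c • (T * S)‖ := norm_sub_le _ _
    _ ≤ ‖S‖ * ‖T‖ + ‖T‖ * ‖S‖ := by
      rw [norm_units_zsmul]
      exact add_le_add (norm_mul_le _ _) (norm_mul_le _ _)
    _ = 2 * (‖S‖ * ‖T‖) := by ring

theorem two_mul_one_sub_mul_norm_le_norm_mul_add_mul [NormedSpace ℝ A] {P : A} {t : ℝ}
    (hP : ‖1 - P‖ ≤ t) (K : A) : 2 * (1 - t) * ‖K‖ ≤ ‖P * K + K * P‖ := by
  have hsplit : K + K = (P * K + K * P) + ((1 - P) * K + K * (1 - P)) := by noncomm_ring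
  have hleft : ‖(1 - P) * K‖ ≤ t * ‖K‖ := (norm_mul_le _ _).trans (by gcongr)
  have hright : ‖K * (1 - P)‖ ≤ ‖K‖ * t := (norm_mul_le _ _).trans (by gcongr)
  have hdouble : 2 * ‖K‖ ≤ ‖P * K + K * P‖ + (t * ‖K‖ + ‖K‖ * t) :=
    calc 2 * ‖K‖ = ‖K + K‖ := by rw [← two_smul ℝ K, norm_smul, Real.norm_two]
      _ ≤ ‖P * K + K * P‖ + ‖(1 - P) * K + K * (1 - P)‖ := hsplit ▸ norm_add_le _ _
      _ ≤ ‖P * K + K * P‖ + (t * ‖K‖ + ‖K‖ * t) := by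
        gcongr
        exact (norm_add_le _ _).trans (add_le_add hleft hright)
  linarith

-- With `P = U B`, which is close to `1`, this expresses `K = U (U T - c T U)` through
-- `B T - c T B`.
theorem IsRounding.mul_add_mul_eq [Star A] {t : ℝ} {U B : A} (hU : IsRounding t U B) (c : ℤˣ)
    (T : A) :
    U * B * (U * twistedComm c U T) + U * twistedComm c U T * (U * B) =
      U * twistedComm c B T - c • (twistedComm c B T * U) := by
  have hUU : U * U = 1 := hU.isStarReflection.2
  have hUUx (x : A) : U * (U * x) = x := by rw [← mul_assoc, hUU, one_mul]
  have hBU : B * U = U * B := hU.commute.eq.symm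
  have hBUx (x : A) : B * (U * x) = U * (B * x) := by rw [← mul_assoc, hBU, mul_assoc]
  rcases Int.units_eq_one_or c with rfl | rfl <;>
    simp only [twistedComm_one, twistedComm_neg_one, Units.neg_smul, one_smul, mul_sub, sub_mul,
      mul_add, add_mul, mul_assoc, hUUx, hBU, hBUx] <;>
    abel

end NormedRing

section CStarRing

variable {A : Type*} [NormedRing A] [StarRing A] [CStarRing A] {R S T U V B C : A}

theorem IsStarReflection.norm_mul (hR : IsStarReflection R) (B : A) : ‖R * B‖ = ‖B‖ :=
  CStarRing.norm_mem_unitary_mul B hR.mem_unitary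

theorem IsStarReflection.mul_norm (hR : IsStarReflection R) (B : A) : ‖B * R‖ = ‖B‖ :=
  CStarRing.norm_mul_mem_unitary B hR.mem_unitary

theorem norm_twistedComm_twistedConj (hR : IsStarReflection R) (a b c : ℤˣ) (S T : A) :
    ‖twistedComm c (twistedConj a R S) (twistedConj b R T)‖ = ‖twistedComm c S T‖ := by
  rw [twistedComm_twistedConj hR.2, norm_units_zsmul, hR.mul_norm, hR.norm_mul]

theorem norm_sub_twistedConj (hR : IsStarReflection R) (a : ℤˣ) (S : A) :
    ‖S - twistedConj a R S‖ = ‖twistedComm a R S‖ := by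
  rw [sub_twistedConj hR.2, norm_neg, norm_units_zsmul, hR.mul_norm]

variable [NormedAlgebra ℝ A] {t : ℝ}

theorem IsRounding.norm_twistedComm_le (hU : IsRounding t U B) (c : ℤˣ) (T : A) :
    (1 - t) * ‖twistedComm c U T‖ ≤ ‖twistedComm c B T‖ := by
  have hUr := hU.isStarReflection
  have hUB : ‖1 - U * B‖ ≤ t := by
    rw [← hUr.2, ← mul_sub, hUr.norm_mul]
    exact hU.near
  have hlower := two_mul_one_sub_mul_norm_le_norm_mul_add_mul hUB (U * twistedComm c U T)
  rw [hU.mul_add_mul_eq, hUr.norm_mul] at hlower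
  have hupper : ‖U * twistedComm c B T - c • (twistedComm c B T * U)‖ ≤
      ‖twistedComm c B T‖ + ‖twistedComm c B T‖ := by
    refine (norm_sub_le _ _).trans_eq ?_
    rw [norm_units_zsmul, hUr.norm_mul, hUr.mul_norm]
  linarith

theorem IsRounding.norm_twistedComm_le_div (hU : IsRounding t U B) (hV : IsRounding t V C)
    (ht : t < 1) (c : ℤˣ) :
    ‖twistedComm c U V‖ ≤ ‖twistedComm c B C‖ / (1 - t) ^ 2 := by
  have hpos : 0 < 1 - t := sub_pos.2 ht
  have hleft := hU.norm_twistedComm_le c V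
  have hright := hV.norm_twistedComm_le c B
  rw [norm_twistedComm_swap, norm_twistedComm_swap c B] at hright
  rw [le_div_iff₀' (pow_pos hpos 2)]
  calc (1 - t) ^ 2 * ‖twistedComm c U V‖ = (1 - t) * ((1 - t) * ‖twistedComm c U V‖) := by ring
    _ ≤ (1 - t) * ‖twistedComm c B V‖ := mul_le_mul_of_nonneg_left hleft hpos.le
    _ ≤ ‖twistedComm c B C‖ := hright

theorem IsRounding.twistedComm_eq_zero (hU : IsRounding t U B) (hV : IsRounding t V C)
    (ht : t < 1) {c : ℤˣ} (h : twistedComm c B C = 0) : twistedComm c U V = 0 := by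
  have hle := hU.norm_twistedComm_le_div hV ht c
  rwa [h, norm_zero, zero_div, norm_le_zero_iff] at hle

theorem norm_twistedPart_sub (hR : IsStarReflection R) (a : ℤˣ) (S : A) :
    ‖twistedPart a R S - S‖ = ‖twistedComm a R S‖ / 2 := by
  rw [twistedPart, midpoint_sub_left, norm_smul, norm_sub_rev, norm_sub_twistedConj hR,
    invOf_eq_inv, norm_inv, Real.norm_two, inv_mul_eq_div]

theorem norm_one_sub_twistedPart_mul_self_le (hR : IsStarReflection R) (hS : S * S = 1) (a : ℤˣ) :
    ‖1 - twistedPart a R S * twistedPart a R S‖ ≤ ‖twistedComm a R S‖ ^ 2 / 4 := by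
  rw [twistedPart, one_sub_midpoint_mul_self hS (twistedConj_mul_self hR.2 hS a), norm_smul,
    ← norm_sub_twistedConj hR]
  have hmul := norm_mul_le (S - twistedConj a R S) (S - twistedConj a R S)
  norm_num
  linarith

-- Write `S = P + P₁` and `T = Q + Q₁`, where `P`, `Q` are the twisted parts. Conjugation by `R`
-- changes the signs of `P₁` and `Q₁`, so averaging leaves no mixed terms `P Q₁`, `P₁ Q`.
theorem norm_twistedComm_twistedPart_le (hR : IsStarReflection R) (a b c : ℤˣ) (S T : A) :
    ‖twistedComm c (twistedPart a R S) (twistedPart b R T)‖ ≤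
      ‖twistedComm c S T‖ + ‖twistedComm a R S‖ * ‖twistedComm b R T‖ / 2 := by
  have havg : ‖(1 / 2 : ℝ) • (twistedComm c S T +
      twistedComm c (twistedConj a R S) (twistedConj b R T))‖ ≤ ‖twistedComm c S T‖ := by
    have hadd := norm_add_le (twistedComm c S T)
      (twistedComm c (twistedConj a R S) (twistedConj b R T))
    rw [norm_twistedComm_twistedConj hR] at hadd
    rw [norm_smul_of_nonneg (by norm_num)]
    linarith
  have hdiff : ‖(1 / 4 : ℝ) • twistedComm c (S - twistedConj a R S) (T - twistedConj b R T)‖ ≤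
      ‖twistedComm a R S‖ * ‖twistedComm b R T‖ / 2 := by
    have hle := norm_twistedComm_le c (S - twistedConj a R S) (T - twistedConj b R T)
    rw [norm_sub_twistedConj hR, norm_sub_twistedConj hR] at hle
    rw [norm_smul_of_nonneg (by norm_num)]
    linarith
  rw [twistedPart, twistedPart, twistedComm_midpoint_midpoint]
  exact (norm_sub_le _ _).trans (add_le_add havg hdiff)

end CStarRing

section CStarAlgebra

variable {A : Type*} [CStarAlgebra A] {B R S : A} {t : ℝ}

theorem exists_isRounding_of_abs_abs_sub_one_le (hB : IsSelfAdjoint B) (ht : 0 ≤ t) (ht1 : t < 1)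
    (h : ∀ x ∈ spectrum ℝ B, |(|x| - 1)| ≤ t) : ∃ U : A, IsRounding t U B := by
  have hne : ∀ x ∈ spectrum ℝ B, |x| ≠ 0 := fun x hx =>
    (show 0 < |x| by linarith [(abs_le.1 (h x hx)).1]).ne'
  have hcont : ContinuousOn (fun x : ℝ => x / |x|) (spectrum ℝ B) :=
    continuousOn_id.div continuous_abs.continuousOn hne
  refine ⟨cfc (fun x : ℝ => x / |x|) B, ⟨cfc_predicate _ B, ?_⟩, ?_, ?_⟩
  · rw [← cfc_mul _ _ B hcont hcont, ← cfc_one ℝ B]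
    refine cfc_congr fun x hx => ?_
    rw [div_mul_div_comm, abs_mul_abs_self, div_self, Pi.one_apply]
    exact mul_self_ne_zero.2 (abs_ne_zero.1 (hne x hx))
  · simpa only [cfc_id ℝ B] using cfc_commute_cfc (fun x : ℝ => x / |x|) id B
  · nth_rw 2 [← cfc_id ℝ B]
    rw [← cfc_sub _ _ B hcont continuousOn_id]
    refine norm_cfc_le ht fun x hx => ?_
    have hsub : x / |x| - id x = x / |x| * (1 - |x|) := by
      rw [id, mul_sub, mul_one, div_mul_cancel₀ _ (hne x hx)]
    rw [hsub, norm_mul, Real.norm_eq_abs, abs_div, abs_abs, div_self (hne x hx), one_mul,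
      Real.norm_eq_abs, abs_sub_comm]
    exact h x hx

theorem IsNearStarReflection.exists_isRounding {ε : ℝ} (hB : IsNearStarReflection ε B)
    (hε : 0 ≤ ε) (hε1 : ε < 1) : ∃ U : A, IsRounding ε U B := by
  refine exists_isRounding_of_abs_abs_sub_one_le hB.1 hε hε1 fun x hx => ?_
  rcases hB.2 hx with ⟨hlo, hhi⟩ | ⟨hlo, hhi⟩
  · rw [abs_of_neg (by linarith : x < 0), abs_le]
    constructor <;> linarith
  · rw [abs_of_pos (by linarith : 0 < x), abs_le]
    constructor <;> linarith

theorem exists_isRounding_of_norm_one_sub_mul_self_le (hB : IsSelfAdjoint B) (ht1 : t < 1)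
    (h : ‖1 - B * B‖ ≤ t) : ∃ U : A, IsRounding t U B := by
  refine exists_isRounding_of_abs_abs_sub_one_le hB ((norm_nonneg _).trans h) ht1 fun x hx => ?_
  have hcfc : cfc (fun y : ℝ => 1 - y * y) B = 1 - B * B := by
    rw [cfc_sub _ _ _, cfc_mul _ _ _, cfc_id' ℝ B, cfc_const_one ℝ _]
  have hfactor : 1 - x * x = -((|x| - 1) * (|x| + 1)) := by
    rw [← abs_mul_abs_self x]
    ring
  calc |(|x| - 1)| ≤ |(|x| - 1)| * |(|x| + 1)| :=
        le_mul_of_one_le_right (abs_nonneg _) <|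
          (le_add_of_nonneg_left (abs_nonneg x)).trans (le_abs_self _)
    _ = ‖1 - x * x‖ := by rw [hfactor, norm_neg, norm_mul, Real.norm_eq_abs, Real.norm_eq_abs]
    _ ≤ ‖1 - B * B‖ := hcfc ▸ norm_apply_le_norm_cfc (fun y : ℝ => 1 - y * y) B hx
    _ ≤ t := h

theorem exists_isRounding_twistedPart {d : ℝ} (hR : IsStarReflection R) (hS : IsStarReflection S)
    {a : ℤˣ} (hd : ‖twistedComm a R S‖ ≤ d) (hd2 : d < 2) :
    ∃ U : A, IsRounding (d ^ 2 / 4) U (twistedPart a R S) := by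
  have hd0 : 0 ≤ d := (norm_nonneg _).trans hd
  refine exists_isRounding_of_norm_one_sub_mul_self_le (isSelfAdjoint_twistedPart hR.1 hS.1 a)
    (by nlinarith) ((norm_one_sub_twistedPart_mul_self_le hR hS.2 a).trans ?_)
  gcongr

theorem exists_twistedComm_eq_zero_of_mem_insert {I : Type*} {c : I → I → ℤˣ}
    (hsymm : ∀ i j, c i j = c j i) (hdiag : ∀ i, c i i = 1) {R : I → A}
    (hR : ∀ i, IsStarReflection (R i)) {s : Set I}
    (hs : ∀ i ∈ s, ∀ j, twistedComm (c i j) (R i) (R j) = 0) {d : ℝ}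
    (hd : ∀ i j, ‖twistedComm (c i j) (R i) (R j)‖ ≤ d) (hd_half : d ≤ 1 / 2) (k : I) :
    ∃ U : I → A, (∀ i, IsStarReflection (U i)) ∧
      (∀ i ∈ insert k s, ∀ j, twistedComm (c i j) (U i) (U j) = 0) ∧
      (∀ i j, ‖twistedComm (c i j) (U i) (U j)‖ ≤ d / (1 - d)) ∧
      ∀ i, ‖U i - R i‖ ≤ d := by
  have hd0 : 0 ≤ d := (norm_nonneg _).trans (hd k k)
  have ht : d ^ 2 / 4 < 1 := by nlinarith
  choose U hU using fun i => exists_isRounding_twistedPart (hR k) (hR i) (hd k i) (by linarith)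
  have hpart (i j : I) := norm_twistedComm_twistedPart_le (hR k) (c k i) (c k j) (c i j) (R i) (R j)
  refine ⟨U, fun i => (hU i).isStarReflection, fun i hi j => ?_, fun i j => ?_, fun i => ?_⟩
  · refine (hU i).twistedComm_eq_zero (hU j) ht ?_
    rcases hi with rfl | hi
    · rw [hdiag, twistedPart_one_self (hR i).2, twistedComm_twistedPart_eq_zero (hR i).2]
    · have hki : ‖twistedComm (c k i) (R k) (R i)‖ = 0 := by
        rw [hsymm, norm_twistedComm_swap, hs i hi, norm_zero]
      simpa only [hs i hi j, hki, norm_zero, zero_mul, zero_div, add_zero, norm_le_zero_iff]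
        using hpart i j
  · have hquad : ‖twistedComm (c k i) (R k) (R i)‖ * ‖twistedComm (c k j) (R k) (R j)‖ ≤ d * d :=
      mul_le_mul (hd k i) (hd k j) (norm_nonneg _) hd0
    have hpoly : (1 - d) * (1 + d / 2) ≤ (1 - d ^ 2 / 4) ^ 2 := by
      nlinarith [pow_nonneg hd0 4, pow_nonneg hd0 3]
    calc ‖twistedComm (c i j) (U i) (U j)‖ ≤ _ := (hU i).norm_twistedComm_le_div (hU j) ht _
      _ ≤ (d * (1 + d / 2)) / (1 - d ^ 2 / 4) ^ 2 := by
        gcongr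
        linarith [hpart i j, hd i j]
      _ ≤ (d * (1 + d / 2)) / ((1 - d) * (1 + d / 2)) := by
        gcongr
        exact mul_pos (by linarith) (by linarith)
      _ = d / (1 - d) := mul_div_mul_right _ _ (by linarith)
  · calc ‖U i - R i‖ ≤ ‖U i - twistedPart (c k i) (R k) (R i)‖ +
          ‖twistedPart (c k i) (R k) (R i) - R i‖ := norm_sub_le_norm_sub_add_norm_sub _ _ _
      _ ≤ d ^ 2 / 4 + d / 2 := by
        rw [norm_twistedPart_sub (hR k)]
        gcongr
        exacts [(hU i).near, hd k i]
      _ ≤ d := by nlinarith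

theorem exists_twistedComm_eq_zero_of_mem_finset {I : Type*} {c : I → I → ℤˣ}
    (hsymm : ∀ i j, c i j = c j i) (hdiag : ∀ i, c i i = 1) {R : I → A}
    (hR : ∀ i, IsStarReflection (R i)) {δ : ℝ}
    (hδ : ∀ i j, ‖twistedComm (c i j) (R i) (R j)‖ ≤ δ) (s : Finset I) (hs : s.card * δ ≤ 1 / 2) :
    ∃ U : I → A, (∀ i, IsStarReflection (U i)) ∧
      (∀ i ∈ s, ∀ j, twistedComm (c i j) (U i) (U j) = 0) ∧
      (∀ i j, ‖twistedComm (c i j) (U i) (U j)‖ ≤ δ / (1 - s.card * δ)) ∧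
      ∀ i, ‖U i - R i‖ ≤ s.card * (2 * δ) := by
  classical
  induction s using Finset.induction_on with
  | empty => exact ⟨R, hR, by simp, by simpa using hδ, by simp⟩
  | insert k s hk ih =>
    rw [Finset.card_insert_of_notMem hk, Nat.cast_succ] at hs ⊢
    have hδ0 : 0 ≤ δ := (norm_nonneg _).trans (hδ k k)
    have hsδ : 0 ≤ s.card * δ := by positivity
    have hpos : 0 < 1 - s.card * δ := by linarith
    obtain ⟨V, hV, hVs, hVd, hVR⟩ := ih (by linarith)
    have hhalf : δ / (1 - s.card * δ) ≤ 1 / 2 := by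
      rw [div_le_iff₀ hpos]
      linarith
    have htwo : δ / (1 - s.card * δ) ≤ 2 * δ := by
      rw [div_le_iff₀ hpos]
      nlinarith
    have hiter : δ / (1 - s.card * δ) / (1 - δ / (1 - s.card * δ)) =
        δ / (1 - (s.card + 1) * δ) := by
      rw [one_sub_div hpos.ne', div_div_div_cancel_right₀ hpos.ne', sub_sub, add_one_mul]
    obtain ⟨U, hU, hUs, hUd, hUV⟩ := exists_twistedComm_eq_zero_of_mem_insert hsymm hdiag hV
      (s := (s : Set I)) hVs hVd hhalf k
    refine ⟨U, hU, fun i hi => hUs i (by simpa using hi), fun i j => hiter ▸ hUd i j, fun i => ?_⟩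
    calc ‖U i - R i‖ ≤ ‖U i - V i‖ + ‖V i - R i‖ := norm_sub_le_norm_sub_add_norm_sub _ _ _
      _ ≤ 2 * δ + s.card * (2 * δ) := add_le_add ((hUV i).trans htwo) (hVR i)
      _ = (s.card + 1) * (2 * δ) := by ring

theorem exists_isStarReflection_twistedComm_eq_zero {I : Type*} [Fintype I] {c : I → I → ℤˣ}
    (hsymm : ∀ i j, c i j = c j i) (hdiag : ∀ i, c i i = 1) {ε : ℝ} {W : I → A}
    (hW : ∀ i, IsNearStarReflection ε (W i))
    (hrel : ∀ i j, ‖twistedComm (c i j) (W i) (W j)‖ ≤ ε) (hε1 : ε < 1)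
    (hcard : Fintype.card I * (ε / (1 - ε) ^ 2) ≤ 1 / 2) :
    ∃ U : I → A, (∀ i, IsStarReflection (U i)) ∧
      (∀ i j, twistedComm (c i j) (U i) (U j) = 0) ∧
      ∀ i, ‖U i - W i‖ ≤ Fintype.card I * (2 * (ε / (1 - ε) ^ 2)) + ε := by
  cases isEmpty_or_nonempty I with
  | inl _ => exact ⟨W, isEmptyElim, isEmptyElim, isEmptyElim⟩
  | inr hI =>
    obtain ⟨i₀⟩ := hI
    have hε0 : 0 ≤ ε := (norm_nonneg _).trans (hrel i₀ i₀)
    choose R hR using fun i => (hW i).exists_isRounding hε0 hε1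
    have hRrel (i j : I) : ‖twistedComm (c i j) (R i) (R j)‖ ≤ ε / (1 - ε) ^ 2 :=
      ((hR i).norm_twistedComm_le_div (hR j) hε1 _).trans (by gcongr; exact hrel i j)
    obtain ⟨U, hU, hUrel, -, hUR⟩ := exists_twistedComm_eq_zero_of_mem_finset hsymm hdiag
      (fun i => (hR i).isStarReflection) hRrel Finset.univ hcard
    exact ⟨U, hU, fun i => hUrel i (Finset.mem_univ i), fun i =>
      (norm_sub_le_norm_sub_add_norm_sub _ (R i) _).trans (add_le_add (hUR i) (hR i).near)⟩

end CStarAlgebra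

section Pauli

variable {J : Type*} [DecidableEq J]

/-- The sign pattern of the Pauli operators of the qubits in `J`: `inl j` labels `X j`, `inr j`
labels `Z j`, and the only anticommuting pairs are those of `X j` and `Z j`. -/
def pauliSign : J ⊕ J → J ⊕ J → ℤˣ
  | .inl i, .inr j => if i = j then -1 else 1
  | .inr i, .inl j => if i = j then -1 else 1
  | _, _ => 1

theorem pauliSign_comm (p q : J ⊕ J) : pauliSign p q = pauliSign q p := by
  rcases p with i | i <;> rcases q with j | j <;> simp only [pauliSign, eq_comm]

theorem pauliSign_self (p : J ⊕ J) : pauliSign p p = 1 := by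
  cases p <;> rfl

theorem norm_twistedComm_pauliSign_le_iff {A : Type*} [NormedRing A] {X Z : J → A} {r : ℝ} :
    (∀ p q, ‖twistedComm (pauliSign p q) (Sum.elim X Z p) (Sum.elim X Z q)‖ ≤ r) ↔
      (∀ j, ‖X j * Z j + Z j * X j‖ ≤ r) ∧
        ∀ S ∈ ({X, Z} : Set (J → A)), ∀ T ∈ ({X, Z} : Set (J → A)),
          ∀ i j, i ≠ j → ‖S i * T j - T j * S i‖ ≤ r := by
  constructor
  · intro h
    refine ⟨fun j => ?_, ?_⟩
    · simpa [pauliSign, twistedComm_neg_one] using h (.inl j) (.inr j)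
    · rintro S (rfl | rfl) T (rfl | rfl) i j hij
      · simpa [pauliSign, twistedComm_one] using h (.inl i) (.inl j)
      · simpa [pauliSign, hij, twistedComm_one] using h (.inl i) (.inr j)
      · simpa [pauliSign, hij, twistedComm_one] using h (.inr i) (.inl j)
      · simpa [pauliSign, twistedComm_one] using h (.inr i) (.inr j)
  · rintro ⟨hanti, hcomm⟩ p q
    have hr (j : J) : 0 ≤ r := (norm_nonneg _).trans (hanti j)
    rcases p with i | i <;> rcases q with j | j <;> rcases eq_or_ne i j with rfl | hij
    · simpa [pauliSign, twistedComm_one_self] using hr i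
    · simpa [pauliSign, twistedComm_one] using hcomm X (by simp) X (by simp) i j hij
    · simpa [pauliSign, twistedComm_neg_one] using hanti i
    · simpa [pauliSign, hij, twistedComm_one] using hcomm X (by simp) Z (by simp) i j hij
    · simpa [pauliSign, twistedComm_neg_one, add_comm] using hanti i
    · simpa [pauliSign, hij, twistedComm_one] using hcomm Z (by simp) X (by simp) i j hij
    · simpa [pauliSign, twistedComm_one_self] using hr i
    · simpa [pauliSign, twistedComm_one] using hcomm Z (by simp) Z (by simp) i j hij

end Pauli

theorem theoremt_general {A J : Type*} [CStarAlgebra A] [Fintype J] {ε : ℝ} {X Z : J → A}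
    (hX : ∀ j, IsNearStarReflection ε (X j)) (hZ : ∀ j, IsNearStarReflection ε (Z j))
    (hXZ : ∀ j, ‖X j * Z j + Z j * X j‖ ≤ ε)
    (hST : ∀ S ∈ ({X, Z} : Set (J → A)), ∀ T ∈ ({X, Z} : Set (J → A)),
      ∀ i j, i ≠ j → ‖S i * T j - T j * S i‖ ≤ ε)
    (hε1 : ε < 1) (hε : ε / (1 - ε) ^ 2 ≤ 1 / (4 * (Fintype.card J : ℝ))) :
    ∃ X' Z' : J → A,
      (∀ j, IsStarReflection (X' j)) ∧ (∀ j, IsStarReflection (Z' j)) ∧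
      (∀ j, X' j * Z' j + Z' j * X' j = 0) ∧
      (∀ S ∈ ({X', Z'} : Set (J → A)), ∀ T ∈ ({X', Z'} : Set (J → A)),
        ∀ i j, i ≠ j → S i * T j - T j * S i = 0) ∧
      (∀ j, ‖X' j - X j‖ ≤ 4 * Fintype.card J * ε / (1 - ε) ^ 2 + ε) ∧
      (∀ j, ‖Z' j - Z j‖ ≤ 4 * Fintype.card J * ε / (1 - ε) ^ 2 + ε) := by
  classical
  have hcard : (Fintype.card (J ⊕ J) : ℝ) = 2 * Fintype.card J := by
    rw [Fintype.card_sum, Nat.cast_add, two_mul]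
  have hsmall : Fintype.card (J ⊕ J) * (ε / (1 - ε) ^ 2) ≤ 1 / 2 :=
    calc Fintype.card (J ⊕ J) * (ε / (1 - ε) ^ 2)
        ≤ 2 * Fintype.card J * (1 / (4 * (Fintype.card J : ℝ))) := by
          rw [hcard]
          gcongr
      _ = Fintype.card J / Fintype.card J / 2 := by ring
      _ ≤ 1 / 2 := by
          gcongr
          exact div_self_le_one _
  obtain ⟨U, hU, hUrel, hUW⟩ := exists_isStarReflection_twistedComm_eq_zero pauliSign_comm
    pauliSign_self (W := Sum.elim X Z) (Sum.forall.2 ⟨hX, hZ⟩)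
    (norm_twistedComm_pauliSign_le_iff.2 ⟨hXZ, hST⟩) hε1 hsmall
  rw [← Sum.elim_comp_inl_inr U] at hUrel
  have hrel := norm_twistedComm_pauliSign_le_iff.1 fun p q => (norm_eq_zero.2 (hUrel p q)).le
  simp only [norm_le_zero_iff] at hrel
  have hbound : Fintype.card (J ⊕ J) * (2 * (ε / (1 - ε) ^ 2)) + ε =
      4 * Fintype.card J * ε / (1 - ε) ^ 2 + ε := by
    rw [hcard]
    ring
  simp only [hbound, Sum.forall] at hUW
  exact ⟨U ∘ Sum.inl, U ∘ Sum.inr, fun j => hU _, fun j => hU _, hrel.1, hrel.2, hUW.1, hUW.2⟩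

/-- Norms of matrices are operator norms with respect to the Euclidean norm. -/
theorem theoremt {ι : Type*} [Fintype ι] [DecidableEq ι] (n : ℕ) (ε : ℝ)
    (X Z : Fin n → Matrix ι ι ℂ)
    (hX : ∀ j, IsNearReflectionMatrix ε (X j))
    (hZ : ∀ j, IsNearReflectionMatrix ε (Z j))
    (hXZ : ∀ j, ‖matAnticomm (X j) (Z j)‖ ≤ ε)
    (hST : ∀ S ∈ ({X, Z} : Set (Fin n → Matrix ι ι ℂ)),
      ∀ T ∈ ({X, Z} : Set (Fin n → Matrix ι ι ℂ)),
        ∀ i j, i ≠ j → ‖matComm (S i) (T j)‖ ≤ ε)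
    (hε_one : ε < 1)
    (hε : ε / (1 - ε) ^ 2 ≤ 1 / (64 * (n : ℝ))) :
    ∃ X' Z' : Fin n → Matrix ι ι ℂ,
      (∀ j, IsReflectionMatrix (X' j)) ∧
      (∀ j, IsReflectionMatrix (Z' j)) ∧
      (∀ j, matAnticomm (X' j) (Z' j) = 0) ∧
      (∀ S ∈ ({X', Z'} : Set (Fin n → Matrix ι ι ℂ)),
        ∀ T ∈ ({X', Z'} : Set (Fin n → Matrix ι ι ℂ)),
          ∀ i j, i ≠ j → matComm (S i) (T j) = 0) ∧
      (∀ j, ‖X' j - X j‖ ≤ 4 * n * ε / (1 - ε) ^ 2 + ε) ∧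
      (∀ j, ‖Z' j - Z j‖ ≤ 4 * n * ε / (1 - ε) ^ 2 + ε) := by
  have h := theoremt_general hX hZ hXZ hST hε_one <| by
    rw [Fintype.card_fin]
    exact hε.trans (by simp only [one_div, mul_inv]; gcongr; norm_num)
  rwa [Fintype.card_fin] at h
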